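/- For $1<p<\infty$ and $\theta>0$, let $L^{p),\theta}([0,1])$ be the grand Lebesgue space of all measurable $f:[0,1]\to\mathbb{R}$ (identified when equal almost everywhere) with $$\|f\|_{L^{p),\theta}([0,1])}=\sup_{0<\varepsilon<p-1}\Big(\varepsilon^{\theta}\int_0^1|f(t)|^{p-\varepsilon}\,dt\Big)^{1/(p-\varepsilon)}<\infty .$$ For $0<\alpha<1$ let $$(I_\alpha f)(x)=\int_0^1\frac{f(y)}{|x-y|^{1-\alpha}}\,dy,\qquad x\in[0,1],$$ be the Riesz potential operator on $[0,1]$. Let $1<p<\infty$, $0<\alpha<1/p$, $q=\dfrac{p}{1-\alpha p}$, $\theta_1>0$ and $\theta_2>(1+\alpha q)\theta_1$. Then $I_\alpha$ is bounded from $L^{p),\theta_1}([0,1])$ to $L^{q),\theta_2}([0,1])$; that is, there is a constant $C<\infty$ such that for every $f\in L^{p),\theta_1}([0,1])$ the integral defining $(I_\alpha f)(x)$ converges absolutely for almost every $x\in[0,1]$, $I_\alpha f\in L^{q),\theta_2}([0,1])$, and $$\|I_\alpha f\|_{L^{q),\theta_2}([0,1])}\le C\,\|f\|_{L^{p),\theta_1}([0,1])}.$$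 -/

import Mathlib

open MeasureTheory Set
open scoped NNReal ENNReal

noncomputable section

/-- The norm of the (unweighted) generalized grand Lebesgue space `L^{p),θ}(Ω)`, for a bounded set
`Ω ⊆ ℝ` and `1 < p < ∞`, with values in `[0, ∞]`:
`sup_{0 < ε < p - 1} ((ε ^ θ / |Ω|) ∫_Ω |f t| ^ (p - ε) dt) ^ (1 / (p - ε))`. -/
def grandNorm (Ω : Set ℝ) (p θ : ℝ) (f : ℝ → ℝ) : ℝ≥0∞ :=
  ⨆ ε ∈ Ioo (0 : ℝ) (p - 1),
    (ENNReal.ofReal (ε ^ θ) / volume Ω * ∫⁻ t in Ω, ‖f t‖ₑ ^ (p - ε)) ^ (1 / (p - ε))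

/-- `f` belongs to `L^{p),θ}(Ω)`: it is (a.e. equal to) a measurable function on `Ω` and its
grand Lebesgue norm is finite. Only the values of `f` on `Ω` matter. -/
def MemGrandLebesgue (Ω : Set ℝ) (p θ : ℝ) (f : ℝ → ℝ) : Prop :=
  AEStronglyMeasurable f (volume.restrict Ω) ∧ grandNorm Ω p θ f < ∞

/-- The kernel integrand `y ↦ f y / |x - y| ^ (1 - α)` of the Riesz potential at the point `x`. -/
def rieszIntegrand (α : ℝ) (f : ℝ → ℝ) (x y : ℝ) : ℝ :=
  f y / |x - y| ^ (1 - α)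

/-- The Riesz potential `(I_α f)(x) = ∫_0^1 f(y) / |x - y| ^ (1 - α) dy` on `[0,1]`. -/
def rieszPotential (α : ℝ) (f : ℝ → ℝ) (x : ℝ) : ℝ :=
  ∫ y in Icc (0 : ℝ) 1, rieszIntegrand α f x y

end

/-!
The heart of the matter is the Hardy–Littlewood–Sobolev inequality `‖I_α f‖_s ≤ C ‖f‖_r` on `[0,1]`,
`1 / s = 1 / r - α`, with a constant that stays bounded for `r` in a compact part of `(1, 1 / α)`
(`exists_lintegral_rieszLIntegral_rpow_le`).

It is proved without maximal functions or interpolation. Let `φ = |f|` with `∫ φ ^ r ≤ 1`, and let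
`g` be the value of the potential of `φ` at `x`. By Hölder's inequality the points with `|x - y| ≥ R`
contribute at most `c R ^ (-1 / s)`; the points with `|x - y| < R` and `φ y ≤ t` contribute at most
`2 t R ^ α / α`. Choosing `R` and `t` so that both bounds equal `g / 4`, at least half of `g` comes
from the points with `|x - y| < R` and `φ y > t`, and at these points `g` is at most a multiple of
`min (|x - y| ^ (-1 / s)) (φ y ^ (r / s))`. Hence
`g ^ s ≤ 2 ∫ φ y |x - y| ^ (α - 1) (M min (|x - y| ^ (-1 / s)) (φ y ^ (r / s))) ^ (s - 1) dy`
(`rieszLIntegral_rpow_le`). Integrating in `x` first, with the domain split at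
`|x - y| = φ y ^ (-r)`, turns the right-hand side into a multiple of `∫ φ ^ r`
(`lintegral_kernel_mul_min_le`).

For the grand norms, write `s = q - η` and `r = p - ε`. Then `ε` and `η` are comparable
(`exists_exponent`), so the weight `ε ^ (-θ₁ s / r)` lost in the source is absorbed by `η ^ θ₂`,
because `s / r = 1 + α s ≤ 1 + α q` and `(1 + α q) θ₁ ≤ θ₂` (`weight_mul_rpow_le`). This covers small
`η`; larger `η`, for which `r` may fail to exceed `1`, follow from monotonicity of `L^s` norms on
`[0,1]`. Almost everywhere absolute convergence holds because the potential of an integrable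
function is integrable (`ae_rieszLIntegral_ne_top`).
-/

/-! ### Power integrals near and away from a point -/

theorem lintegral_comp_abs_sub (h : ℝ → ℝ≥0∞) (hh : Measurable h) (y : ℝ) :
    ∫⁻ x, h |x - y| = 2 * ∫⁻ z in Ioi (0 : ℝ), h z := by
  have e1 : ∫⁻ x, h |x - y| = ∫⁻ x, h |x| := lintegral_sub_right_eq_self (fun x => h |x|) y
  have e2 : ∫⁻ x in Ioi (0 : ℝ), h |x| = ∫⁻ z in Ioi (0 : ℝ), h z :=
    setLIntegral_congr_fun measurableSet_Ioi fun x hx => by rw [abs_of_pos hx]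
  have e3 : ∫⁻ x in Iic (0 : ℝ), h |x| = ∫⁻ z in Ioi (0 : ℝ), h z := by
    have := (Measure.measurePreserving_neg (volume : Measure ℝ)).setLIntegral_comp_preimage
      (measurableSet_Ici (a := (0 : ℝ))) (f := fun x => h |x|) (by fun_prop)
    simp only [abs_neg, neg_preimage, neg_Ici, neg_zero] at this
    rw [this, setLIntegral_congr Ioi_ae_eq_Ici.symm, e2]
  rw [e1, ← setLIntegral_univ, ← Iic_union_Ioi (a := (0 : ℝ)),
    lintegral_union measurableSet_Ioi (Iic_disjoint_Ioi le_rfl), e2, e3, two_mul]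

theorem setLIntegral_abs_sub_lt_rpow {a R : ℝ} (ha : -1 < a) (hR : 0 < R) (y : ℝ) :
    ∫⁻ x in {x | |x - y| < R}, ENNReal.ofReal (|x - y| ^ a)
      = ENNReal.ofReal (2 * R ^ (a + 1) / (a + 1)) := by
  have hm : MeasurableSet {x : ℝ | |x - y| < R} :=
    measurableSet_lt (by fun_prop) measurable_const
  have h1 := lintegral_comp_abs_sub ((Iio R).indicator fun z => ENNReal.ofReal (z ^ a))
    (Measurable.indicator (by fun_prop) measurableSet_Iio) y
  have hint : IntegrableOn (fun z : ℝ => z ^ a) (Ioo 0 R) :=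
    (intervalIntegral.integrableOn_Ioo_rpow_iff hR).2 ha
  rw [← lintegral_indicator hm]
  refine Eq.trans ?_ (h1.trans ?_)
  · rfl
  · rw [lintegral_indicator measurableSet_Iio, Measure.restrict_restrict measurableSet_Iio,
      inter_comm, Ioi_inter_Iio, ← ofReal_integral_eq_lintegral_ofReal hint
        ((ae_restrict_iff' measurableSet_Ioo).2 (ae_of_all _ fun z hz => Real.rpow_nonneg hz.1.le a)),
      ← integral_Ioc_eq_integral_Ioo, ← intervalIntegral.integral_of_le hR.le,
      integral_rpow (Or.inl ha), Real.zero_rpow (by linarith), sub_zero, mul_div_assoc,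
      ENNReal.ofReal_mul zero_le_two]
    simp

theorem setLIntegral_le_abs_sub_rpow {b R : ℝ} (hb : b < -1) (hR : 0 < R) (y : ℝ) :
    ∫⁻ x in {x | R ≤ |x - y|}, ENNReal.ofReal (|x - y| ^ b)
      = ENNReal.ofReal (2 * R ^ (b + 1) / (-(b + 1))) := by
  have hm : MeasurableSet {x : ℝ | R ≤ |x - y|} :=
    measurableSet_le measurable_const (by fun_prop)
  have h1 := lintegral_comp_abs_sub ((Ici R).indicator fun z => ENNReal.ofReal (z ^ b))
    (Measurable.indicator (by fun_prop) measurableSet_Ici) y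
  have hint := integrableOn_Ioi_rpow_of_lt hb hR
  rw [← lintegral_indicator hm]
  refine Eq.trans ?_ (h1.trans ?_)
  · rfl
  · have hs : Ici R ∩ Ioi 0 = Ici R := inter_eq_left.2 fun z hz => hR.trans_le hz
    rw [lintegral_indicator measurableSet_Ici, Measure.restrict_restrict measurableSet_Ici,
      hs, setLIntegral_congr Ioi_ae_eq_Ici.symm, ← ofReal_integral_eq_lintegral_ofReal hint
        ((ae_restrict_iff' measurableSet_Ioi).2
          (ae_of_all _ fun z hz => Real.rpow_nonneg (hR.trans hz).le b)),
      integral_Ioi_rpow_of_lt hb hR, mul_div_assoc, ENNReal.ofReal_mul zero_le_two, neg_div,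
      div_neg]
    simp

/-! ### The potential with values in `[0, ∞]` -/

/-- The Riesz potential of order `α` on `[0,1]` of a function `φ`, as an integral with values in
`[0, ∞]`. It is the intended object for `φ ≥ 0` only: `ENNReal.ofReal` cuts off negative values. -/
noncomputable def rieszLIntegral (α : ℝ) (φ : ℝ → ℝ) (x : ℝ) : ℝ≥0∞ :=
  ∫⁻ y in Icc (0 : ℝ) 1, ENNReal.ofReal (φ y * |x - y| ^ (α - 1))

theorem measurable_rieszLIntegral {α : ℝ} {φ : ℝ → ℝ} (hφ : Measurable φ) :
    Measurable (rieszLIntegral α φ) := by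
  unfold rieszLIntegral
  exact Measurable.lintegral_prod_right' (f := fun z : ℝ × ℝ =>
    ENNReal.ofReal (φ z.2 * |z.1 - z.2| ^ (α - 1))) (by fun_prop)

/-- The part of the potential that comes from `|x - y| ≥ R`, by Hölder's inequality. The bound `c`
need not depend on `r`. -/
theorem lintegral_far_le {α r c R : ℝ} (hr : 1 < r) (hαr : α * r < 1)
    (hc : 1 ≤ c) (hc' : 2 * (r - 1) / (1 - α * r) ≤ c) (hR : 0 < R)
    {φ : ℝ → ℝ} (hφ : Measurable φ) (hφ0 : ∀ y, 0 ≤ φ y)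
    (h1 : ∫⁻ y in Icc (0 : ℝ) 1, ENNReal.ofReal (φ y ^ r) ≤ 1) (x : ℝ) :
    ∫⁻ y in Icc (0 : ℝ) 1, {y | R ≤ |x - y|}.indicator
        (fun y => ENNReal.ofReal (φ y * |x - y| ^ (α - 1))) y
      ≤ ENNReal.ofReal (c * R ^ (α - 1 / r)) := by
  have hr0 : 0 < r := by linarith
  have hr1 : 0 < r - 1 := by linarith
  have hpq : r.HolderConjugate (r / (r - 1)) := Real.HolderConjugate.conjExponent hr
  set r' := r / (r - 1) with hr'
  have hr'0 : 0 < r' := by positivity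
  have hm : MeasurableSet {y : ℝ | R ≤ |x - y|} :=
    measurableSet_le measurable_const (by fun_prop)
  have hb : (α - 1) * r' < -1 := by
    rw [hr', mul_div_assoc', div_lt_iff₀ hr1]; nlinarith
  have hk := setLIntegral_le_abs_sub_rpow hb hR x
  calc _ = ∫⁻ y in Icc (0 : ℝ) 1, ENNReal.ofReal (φ y) *
        {y | R ≤ |x - y|}.indicator (fun y => ENNReal.ofReal (|x - y| ^ (α - 1))) y := by
        refine lintegral_congr fun y => ?_
        by_cases h : R ≤ |x - y| <;> simp [indicator, h, ENNReal.ofReal_mul (hφ0 y)]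
    _ ≤ _ := ENNReal.lintegral_mul_le_Lp_mul_Lq _ hpq (by fun_prop)
        (Measurable.indicator (by fun_prop) hm).aemeasurable
    _ ≤ 1 * (ENNReal.ofReal (2 * R ^ ((α - 1) * r' + 1) / (-((α - 1) * r' + 1)))) ^ (1 / r') := by
        gcongr
        · refine ENNReal.rpow_le_one ?_ (by positivity)
          refine le_trans (le_of_eq (lintegral_congr fun y => ?_)) h1
          rw [ENNReal.ofReal_rpow_of_nonneg (hφ0 y) hr0.le]
        · have hm' : MeasurableSet {y : ℝ | R ≤ |y - x|} :=
            measurableSet_le measurable_const (by fun_prop)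
          rw [← hk, ← lintegral_indicator hm']
          refine (setLIntegral_le_lintegral _ _).trans (lintegral_mono fun y => ?_)
          by_cases h : R ≤ |x - y|
          · simp [indicator, h, ENNReal.ofReal_rpow_of_nonneg, Real.rpow_nonneg,
              hr'0.le, ← Real.rpow_mul, abs_sub_comm]
          · simp [indicator, h, hr'0]
    _ ≤ _ := by
        have hd : 0 < -((α - 1) * r' + 1) := by linarith
        have h2 : 2 / (-((α - 1) * r' + 1)) ≤ c := by
          refine le_trans (le_of_eq ?_) hc'
          have h3 : 1 - α * r ≠ 0 := by linarith
          have h4 : -((α - 1) * r' + 1) = (1 - α * r) / (r - 1) := by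
            rw [hr']; field_simp; ring
          rw [h4]; field_simp
        rw [one_mul, ENNReal.ofReal_rpow_of_nonneg (by positivity) (by positivity)]
        refine ENNReal.ofReal_le_ofReal ?_
        have h5 : ((α - 1) * r' + 1) * (1 / r') = α - 1 / r := by
          rw [hr']; field_simp; ring
        rw [mul_div_right_comm, Real.mul_rpow (by positivity) (by positivity), ← Real.rpow_mul hR.le,
          h5]
        gcongr
        calc _ ≤ c ^ (1 / r') := by gcongr
          _ ≤ c ^ (1 : ℝ) := by
            refine Real.rpow_le_rpow_of_exponent_le hc ?_
            rw [div_le_one hr'0, hr', le_div_iff₀ hr1]; linarith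
          _ = c := Real.rpow_one c

/-! ### Pointwise bound for the potential -/

/-- The part of the potential that comes from `|x - y| < R`, `φ y ≤ t`. -/
theorem lintegral_near_le {α R t : ℝ} (hα : 0 < α) (hR : 0 < R) (ht : 0 ≤ t)
    {φ : ℝ → ℝ} (x : ℝ) :
    ∫⁻ y in Icc (0 : ℝ) 1, {y | |x - y| < R ∧ φ y ≤ t}.indicator
        (fun y => ENNReal.ofReal (φ y * |x - y| ^ (α - 1))) y
      ≤ ENNReal.ofReal (t * (2 * R ^ α / α)) := by
  have hm' : MeasurableSet {y : ℝ | |y - x| < R} :=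
    measurableSet_lt (by fun_prop) measurable_const
  have hk := setLIntegral_abs_sub_lt_rpow (a := α - 1) (by linarith) hR x
  rw [sub_add_cancel] at hk
  rw [ENNReal.ofReal_mul ht, ← hk, ← lintegral_const_mul _ (by fun_prop),
    ← lintegral_indicator hm']
  refine (setLIntegral_le_lintegral _ _).trans (lintegral_mono fun y => ?_)
  by_cases h : |x - y| < R ∧ φ y ≤ t
  · have h' : |y - x| < R := by rw [abs_sub_comm]; exact h.1
    simp only [indicator, h, h', mem_ofPred_eq, if_true, and_self]
    rw [← ENNReal.ofReal_mul ht, abs_sub_comm]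
    exact ENNReal.ofReal_le_ofReal (mul_le_mul_of_nonneg_right h.2 (by positivity))
  · simp [indicator, h]

/-- On the set `|x - y| < R`, `t < φ y`, where `R` and `t` are tuned to the value `g` of the
potential at `x`, this value is controlled both by the distance and by the size of `φ y`. -/
theorem le_mul_min_of_mem_near {α r s c g M d u : ℝ} (hα : 0 < α) (hα1 : α < 1) (hr : 0 < r)
    (hs : 0 < s) (hrs : α - 1 / r = -(1 / s)) (hc : 1 ≤ c) (hg : 0 < g)
    (hM1 : 4 * c ≤ M) (hM2 : 8 / α * (4 * c) ^ (α * s) ≤ M)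
    (hd : 0 < d) (hdR : d < (4 * c / g) ^ s)
    (hu : α / 8 * g * (g / (4 * c)) ^ (α * s) < u) :
    g ≤ M * min (d ^ (-(1 / s))) (u ^ (r / s)) := by
  have hu0 : 0 < u := lt_of_le_of_lt (by positivity) hu
  have hM : 0 < M := by linarith
  rw [mul_min_of_nonneg _ _ hM.le, le_min_iff]
  constructor
  · have h1 : d ^ (1 / s) ≤ 4 * c / g := by
      calc d ^ (1 / s) ≤ ((4 * c / g) ^ s) ^ (1 / s) := by gcongr
        _ = _ := by rw [← Real.rpow_mul (by positivity), mul_one_div_cancel hs.ne', Real.rpow_one]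
    rw [Real.rpow_neg hd.le]
    have h2 : 0 < d ^ (1 / s) := by positivity
    rw [le_div_iff₀ hg] at h1
    rw [← div_eq_mul_inv, le_div_iff₀ h2]
    linarith
  · have e : (1 + α * s) * (r / s) = 1 := by
      field_simp at hrs ⊢; linarith
    have hrs1 : r / s ≤ 1 := by
      have : r / s = 1 - α * r := by field_simp at hrs ⊢; linarith
      nlinarith
    have hB : 1 ≤ 8 / α * (4 * c) ^ (α * s) := by
      have h1 : 1 ≤ 8 / α := by rw [le_div_iff₀ hα]; linarith
      have h2 : 1 ≤ (4 * c) ^ (α * s) := Real.one_le_rpow (by linarith) (by positivity)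
      nlinarith
    have h3 : g ^ (1 + α * s) ≤ 8 / α * (4 * c) ^ (α * s) * u := by
      rw [Real.div_rpow hg.le (by positivity)] at hu
      rw [Real.rpow_add hg, Real.rpow_one]
      have : 0 < (4 * c) ^ (α * s) := by positivity
      calc g * g ^ (α * s)
          = 8 / α * (4 * c) ^ (α * s) * (α / 8 * g * (g ^ (α * s) / (4 * c) ^ (α * s))) := by
            field_simp
        _ ≤ _ := by gcongr
    calc g = (g ^ (1 + α * s)) ^ (r / s) := by rw [← Real.rpow_mul hg.le, e, Real.rpow_one]
      _ ≤ (8 / α * (4 * c) ^ (α * s) * u) ^ (r / s) := by gcongr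
      _ = (8 / α * (4 * c) ^ (α * s)) ^ (r / s) * u ^ (r / s) :=
        Real.mul_rpow (by positivity) hu0.le
      _ ≤ M * u ^ (r / s) := by
        gcongr
        calc _ ≤ (8 / α * (4 * c) ^ (α * s)) ^ (1 : ℝ) :=
              Real.rpow_le_rpow_of_exponent_le hB hrs1
          _ ≤ M := by rwa [Real.rpow_one]

/-- Pointwise linearization of the `s`-th power of the potential. At least half of the value `g` at
`x` comes from those `y` with `|x - y| < R` and `φ y > t`, for suitable `R` and `t` that depend on
`g`. For such `y`, `le_mul_min_of_mem_near` bounds the remaining factor `g ^ (s - 1)` by an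
expression in `|x - y|` and `φ y` alone. -/
theorem rieszLIntegral_rpow_le {α r s c M : ℝ} (hα : 0 < α) (hα1 : α < 1) (hr : 1 < r)
    (hαr : α * r < 1) (hs : 1 < s) (hrs : α - 1 / r = -(1 / s))
    (hc : 1 ≤ c) (hc' : 2 * (r - 1) / (1 - α * r) ≤ c)
    (hM1 : 4 * c ≤ M) (hM2 : 8 / α * (4 * c) ^ (α * s) ≤ M)
    {φ : ℝ → ℝ} (hφ : Measurable φ) (hφ0 : ∀ y, 0 ≤ φ y)
    (h1 : ∫⁻ y in Icc (0 : ℝ) 1, ENNReal.ofReal (φ y ^ r) ≤ 1) (x : ℝ)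
    (hx : rieszLIntegral α φ x ≠ ∞) :
    rieszLIntegral α φ x ^ s ≤ ∫⁻ y in Icc (0 : ℝ) 1, ENNReal.ofReal
      (2 * φ y * |x - y| ^ (α - 1) *
        (M * min (|x - y| ^ (-(1 / s))) (φ y ^ (r / s))) ^ (s - 1)) := by
  have hs0 : 0 < s := by linarith
  rcases eq_or_ne (rieszLIntegral α φ x) 0 with h0 | h0
  · rw [h0, ENNReal.zero_rpow_of_pos hs0]; exact zero_le
  obtain ⟨g, hg, hG⟩ : ∃ g : ℝ, 0 < g ∧ rieszLIntegral α φ x = ENNReal.ofReal g :=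
    ⟨_, ENNReal.toReal_pos h0 hx, (ENNReal.ofReal_toReal hx).symm⟩
  -- With these choices the far part and the part with `φ y ≤ t` are each at most `g / 4`.
  set R := (4 * c / g) ^ s with hR
  set t := α / 8 * g * (g / (4 * c)) ^ (α * s) with ht
  have hR0 : 0 < R := by positivity
  have ht0 : 0 < t := by positivity
  set K : ℝ → ℝ≥0∞ := fun y => ENNReal.ofReal (φ y * |x - y| ^ (α - 1)) with hK
  have hKm : Measurable K := by fun_prop
  have hfar := lintegral_far_le hr hαr hc hc' hR0 hφ hφ0 h1 x
  have hnear := lintegral_near_le (φ := φ) hα hR0 ht0.le x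
  have efar : c * R ^ (α - 1 / r) = g / 4 := by
    rw [hrs, hR, ← Real.rpow_mul (by positivity), mul_neg, mul_one_div_cancel hs0.ne',
      Real.rpow_neg_one]
    field_simp
  have enear : t * (2 * R ^ α / α) = g / 4 := by
    have : (g / (4 * c)) ^ (α * s) * R ^ α = 1 := by
      rw [hR, ← Real.rpow_mul (by positivity), mul_comm s α,
        ← Real.mul_rpow (by positivity) (by positivity)]
      have : g / (4 * c) * (4 * c / g) = 1 := by field_simp
      rw [this, Real.one_rpow]
    calc t * (2 * R ^ α / α) = g / 4 * ((g / (4 * c)) ^ (α * s) * R ^ α) := by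
          rw [ht]; field_simp; ring
      _ = g / 4 := by rw [this, mul_one]
  rw [efar] at hfar
  rw [enear] at hnear
  set B := ∫⁻ y in Icc (0 : ℝ) 1, {y | |x - y| < R ∧ t < φ y}.indicator K y with hB
  have mfar : MeasurableSet {y | R ≤ |x - y|} := measurableSet_le measurable_const (by fun_prop)
  have mnear : MeasurableSet {y | |x - y| < R ∧ φ y ≤ t} :=
    MeasurableSet.inter (s₁ := {y | |x - y| < R}) (s₂ := {y | φ y ≤ t})
      (measurableSet_lt (by fun_prop) measurable_const) (measurableSet_le hφ measurable_const)
  have hsplit : ENNReal.ofReal g ≤ ENNReal.ofReal (g / 4) + ENNReal.ofReal (g / 4) + B := by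
    refine le_trans ?_ (add_le_add (add_le_add hfar hnear) le_rfl)
    rw [← hG, hB, ← lintegral_add_left (hKm.indicator mfar),
      ← lintegral_add_left (f := fun y => {y | R ≤ |x - y|}.indicator K y + _)
        ((hKm.indicator mfar).add (hKm.indicator mnear))]
    refine lintegral_mono fun y => ?_
    rcases le_or_gt R |x - y| with h | h
    · simp [indicator, h, h.not_gt, hK]
    · rcases le_or_gt (φ y) t with h' | h'
      · simp [indicator, h, h.not_ge, h', h'.not_gt, hK]
      · simp [indicator, h, h.not_ge, h', h'.not_ge, hK]
  have hBg : ENNReal.ofReal (g / 2) ≤ B := by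
    have e : ENNReal.ofReal g
        = ENNReal.ofReal (g / 4) + ENNReal.ofReal (g / 4) + ENNReal.ofReal (g / 2) := by
      rw [← ENNReal.ofReal_add (by positivity) (by positivity),
        ← ENNReal.ofReal_add (by positivity) (by positivity)]
      congr 1; ring
    rw [e] at hsplit
    exact (ENNReal.add_le_add_iff_left (by simp)).1 hsplit
  calc rieszLIntegral α φ x ^ s = ENNReal.ofReal (2 * g ^ (s - 1)) * ENNReal.ofReal (g / 2) := by
        rw [hG, ENNReal.ofReal_rpow_of_pos hg, ← ENNReal.ofReal_mul (by positivity),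
          Real.rpow_sub_one hg.ne']
        congr 1; field_simp
    _ ≤ ENNReal.ofReal (2 * g ^ (s - 1)) * B := by gcongr
    _ ≤ _ := by
        rw [hB, ← lintegral_const_mul' _ _ ENNReal.ofReal_ne_top]
        refine lintegral_mono fun y => ?_
        by_cases h : |x - y| < R ∧ t < φ y
        · simp only [indicator, h, mem_ofPred_eq, if_true, and_self, hK]
          rw [← ENNReal.ofReal_mul (by positivity)]
          refine ENNReal.ofReal_le_ofReal ?_
          rcases (abs_nonneg (x - y)).eq_or_lt with hd | hd
          -- on the diagonal the kernel has the junk value `0 ^ (α - 1) = 0`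
          · rw [← hd, Real.zero_rpow (by linarith)]; simp
          · have hmin := le_mul_min_of_mem_near hα hα1 (by linarith) hs0 hrs hc hg hM1 hM2 hd h.1 h.2
            have h3 : g ^ (s - 1) ≤ (M * min (|x - y| ^ (-(1 / s))) (φ y ^ (r / s))) ^ (s - 1) :=
              Real.rpow_le_rpow hg.le hmin (by linarith)
            have h4 : 0 ≤ 2 * φ y * |x - y| ^ (α - 1) := by have := hφ0 y; positivity
            calc _ = 2 * φ y * |x - y| ^ (α - 1) * g ^ (s - 1) := by ring
              _ ≤ _ := mul_le_mul_of_nonneg_left h3 h4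
        · simp [indicator, h]

/-! ### The Hardy–Littlewood–Sobolev inequality with a uniform constant -/

/-- Integral in `x` of the majorant that `rieszLIntegral_rpow_le` gives for a fixed `y`, with
`u = φ y`. The two powers of `u` that come up are both `u ^ r`, since `1 / s = 1 / r - α`. -/
theorem lintegral_kernel_mul_min_le {α r s M u : ℝ} (hα : 0 < α) (hr : 1 < r) (hs : 1 < s)
    (hrs : α - 1 / r = -(1 / s)) (hM : 0 ≤ M) (hu : 0 ≤ u) (y : ℝ) :
    ∫⁻ x, ENNReal.ofReal
        (2 * u * |x - y| ^ (α - 1) * (M * min (|x - y| ^ (-(1 / s))) (u ^ (r / s))) ^ (s - 1))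
      ≤ ENNReal.ofReal (2 * M ^ (s - 1) * (2 / α + 2 / (1 - 1 / r)) * u ^ r) := by
  have hr0 : 0 < r := by linarith
  have hs0 : 0 < s := by linarith
  have hr1 : 0 < 1 - 1 / r := by rw [sub_pos, div_lt_one hr0]; exact hr
  rcases hu.eq_or_lt with h0 | hu
  · simp [← h0]
  -- The two terms of the minimum agree at `|x - y| = u ^ (-r)`.
  set ρ := u ^ (-r) with hρ
  have hρ0 : 0 < ρ := by positivity
  set A := 2 * M ^ (s - 1) with hA
  have hA0 : 0 ≤ A := by positivity
  have mnear : MeasurableSet {x : ℝ | |x - y| < ρ} :=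
    measurableSet_lt (by fun_prop) measurable_const
  have mfar : MeasurableSet {x : ℝ | ρ ≤ |x - y|} :=
    measurableSet_le measurable_const (by fun_prop)
  have inear := setLIntegral_abs_sub_lt_rpow (a := α - 1) (by linarith) hρ0 y
  have ifar := setLIntegral_le_abs_sub_rpow (b := 1 / r - 2) (by linarith) hρ0 y
  have enear : A * u ^ (1 + r / s * (s - 1)) * (2 * ρ ^ (α - 1 + 1) / (α - 1 + 1))
      = A * (2 / α) * u ^ r := by
    have : u ^ (1 + r / s * (s - 1)) * ρ ^ α = u ^ r := by
      rw [hρ, ← Real.rpow_mul hu.le, ← Real.rpow_add hu]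
      congr 1
      field_simp at hrs ⊢; linear_combination -hrs
    rw [sub_add_cancel, ← this]; ring
  have efar : A * u * (2 * ρ ^ (1 / r - 2 + 1) / -(1 / r - 2 + 1))
      = A * (2 / (1 - 1 / r)) * u ^ r := by
    have : u * ρ ^ (1 / r - 2 + 1) = u ^ r := by
      rw [hρ, ← Real.rpow_mul hu.le]
      nth_rewrite 1 [← Real.rpow_one u]
      rw [← Real.rpow_add hu]
      congr 1
      field_simp; ring
    rw [← this, show -(1 / r - 2 + 1) = 1 - 1 / r by ring]; ring
  calc _ ≤ ∫⁻ x, ({x : ℝ | |x - y| < ρ}.indicator (fun x =>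
            ENNReal.ofReal (A * u ^ (1 + r / s * (s - 1))) * ENNReal.ofReal (|x - y| ^ (α - 1))) x
          + {x : ℝ | ρ ≤ |x - y|}.indicator (fun x =>
            ENNReal.ofReal (A * u) * ENNReal.ofReal (|x - y| ^ (1 / r - 2))) x) := by
        refine lintegral_mono fun x => ?_
        rcases lt_or_ge |x - y| ρ with h | h
        · simp only [indicator, h, h.not_ge, mem_ofPred_eq, if_true, if_false, add_zero]
          rw [← ENNReal.ofReal_mul (by positivity)]
          refine ENNReal.ofReal_le_ofReal ?_
          calc _ ≤ 2 * u * |x - y| ^ (α - 1) * (M * u ^ (r / s)) ^ (s - 1) := by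
                gcongr
                exact min_le_right _ _
            _ = _ := by
                rw [Real.mul_rpow hM (by positivity), ← Real.rpow_mul hu.le, Real.rpow_add hu,
                  Real.rpow_one, hA]
                ring
        · have hd : 0 < |x - y| := hρ0.trans_le h
          simp only [indicator, h, h.not_gt, mem_ofPred_eq, if_true, if_false, zero_add]
          rw [← ENNReal.ofReal_mul (by positivity)]
          refine ENNReal.ofReal_le_ofReal ?_
          calc _ ≤ 2 * u * |x - y| ^ (α - 1) * (M * |x - y| ^ (-(1 / s))) ^ (s - 1) := by
                gcongr
                exact min_le_left _ _
            _ = A * u * (|x - y| ^ (α - 1) * |x - y| ^ (-(1 / s) * (s - 1))) := by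
                rw [Real.mul_rpow hM (by positivity), ← Real.rpow_mul hd.le, hA]
                ring
            _ = _ := by
                rw [← Real.rpow_add hd]
                congr 2
                field_simp at hrs ⊢; linear_combination hrs
    _ = ENNReal.ofReal (A * (2 / α) * u ^ r) + ENNReal.ofReal (A * (2 / (1 - 1 / r)) * u ^ r) := by
        rw [lintegral_add_left (Measurable.indicator (by fun_prop) mnear),
          lintegral_indicator mnear, lintegral_indicator mfar,
          lintegral_const_mul _ (by fun_prop), lintegral_const_mul _ (by fun_prop), inear, ifar,
          ← ENNReal.ofReal_mul (by positivity), ← ENNReal.ofReal_mul (by positivity), enear, efar]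
    _ = _ := by
        rw [← ENNReal.ofReal_add (by positivity) (by positivity)]
        congr 1; ring

theorem ae_rieszLIntegral_ne_top {α r : ℝ} (hα : 0 < α) (hr : 1 ≤ r)
    {φ : ℝ → ℝ} (hφ : Measurable φ) (hφ0 : ∀ y, 0 ≤ φ y)
    (h1 : ∫⁻ y in Icc (0 : ℝ) 1, ENNReal.ofReal (φ y ^ r) ≠ ∞) :
    ∀ᵐ x ∂(volume.restrict (Icc (0 : ℝ) 1)), rieszLIntegral α φ x ≠ ∞ := by
  have hφi : ∫⁻ y in Icc (0 : ℝ) 1, ENNReal.ofReal (φ y) ≠ ∞ := by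
    refine ne_top_of_le_ne_top (b := ∫⁻ y in Icc (0 : ℝ) 1, (1 + ENNReal.ofReal (φ y ^ r))) ?_ ?_
    · rw [lintegral_add_left measurable_const]
      simp [h1]
    · refine lintegral_mono fun y => ?_
      rcases le_total (φ y) 1 with h | h
      · exact le_add_right (by simpa using h)
      · refine le_add_left (ENNReal.ofReal_le_ofReal ?_)
        exact Real.self_le_rpow_of_one_le h hr
  have hk : ∀ y ∈ Icc (0 : ℝ) 1, ∫⁻ x in Icc (0 : ℝ) 1, ENNReal.ofReal (|x - y| ^ (α - 1))
      ≤ ENNReal.ofReal (2 * 2 ^ α / α) := by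
    intro y hy
    have := setLIntegral_abs_sub_lt_rpow (a := α - 1) (R := 2) (by linarith) two_pos y
    rw [sub_add_cancel] at this
    rw [← this]
    refine lintegral_mono_set fun x hx => ?_
    rw [mem_ofPred_eq, abs_sub_lt_iff]
    constructor <;> linarith [hx.1, hx.2, hy.1, hy.2]
  refine (ae_lt_top (measurable_rieszLIntegral hφ) ?_).mono fun x hx => hx.ne
  unfold rieszLIntegral
  rw [lintegral_lintegral_swap (by fun_prop)]
  refine ne_top_of_le_ne_top (b := ∫⁻ y in Icc (0 : ℝ) 1,
    ENNReal.ofReal (φ y) * ENNReal.ofReal (2 * 2 ^ α / α)) ?_ ?_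
  · rw [lintegral_mul_const _ (by fun_prop)]
    exact ENNReal.mul_ne_top hφi ENNReal.ofReal_ne_top
  · refine setLIntegral_mono (by fun_prop) fun y hy => ?_
    calc _ = ENNReal.ofReal (φ y) * ∫⁻ x in Icc (0 : ℝ) 1, ENNReal.ofReal (|x - y| ^ (α - 1)) := by
          rw [← lintegral_const_mul _ (by fun_prop)]
          simp only [ENNReal.ofReal_mul (hφ0 y)]
      _ ≤ _ := by gcongr; exact hk y hy

/-- The Hardy–Littlewood–Sobolev inequality for normalized `φ`, with an explicit constant. -/
theorem lintegral_rieszLIntegral_rpow_le_of_le_one {α r s c M : ℝ} (hα : 0 < α) (hα1 : α < 1)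
    (hr : 1 < r) (hαr : α * r < 1) (hs : 1 < s) (hrs : α - 1 / r = -(1 / s))
    (hc : 1 ≤ c) (hc' : 2 * (r - 1) / (1 - α * r) ≤ c)
    (hM1 : 4 * c ≤ M) (hM2 : 8 / α * (4 * c) ^ (α * s) ≤ M)
    {φ : ℝ → ℝ} (hφ : Measurable φ) (hφ0 : ∀ y, 0 ≤ φ y)
    (h1 : ∫⁻ y in Icc (0 : ℝ) 1, ENNReal.ofReal (φ y ^ r) ≤ 1) :
    ∫⁻ x in Icc (0 : ℝ) 1, rieszLIntegral α φ x ^ s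
      ≤ ENNReal.ofReal (2 * M ^ (s - 1) * (2 / α + 2 / (1 - 1 / r))) := by
  have hM : 0 ≤ M := by linarith
  have hr1 : 0 < 1 - 1 / r := by rw [sub_pos, div_lt_one (by linarith)]; exact hr
  calc _ ≤ ∫⁻ x in Icc (0 : ℝ) 1, ∫⁻ y in Icc (0 : ℝ) 1, ENNReal.ofReal
          (2 * φ y * |x - y| ^ (α - 1) *
            (M * min (|x - y| ^ (-(1 / s))) (φ y ^ (r / s))) ^ (s - 1)) :=
        lintegral_mono_ae ((ae_rieszLIntegral_ne_top hα hr.le hφ hφ0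
          (ne_top_of_le_ne_top ENNReal.one_ne_top h1)).mono fun x hx =>
            rieszLIntegral_rpow_le hα hα1 hr hαr hs hrs hc hc' hM1 hM2 hφ hφ0 h1 x hx)
    _ = ∫⁻ y in Icc (0 : ℝ) 1, ∫⁻ x in Icc (0 : ℝ) 1, ENNReal.ofReal
          (2 * φ y * |x - y| ^ (α - 1) *
            (M * min (|x - y| ^ (-(1 / s))) (φ y ^ (r / s))) ^ (s - 1)) :=
        lintegral_lintegral_swap (by fun_prop)
    _ ≤ ∫⁻ y in Icc (0 : ℝ) 1,
          ENNReal.ofReal (2 * M ^ (s - 1) * (2 / α + 2 / (1 - 1 / r)) * φ y ^ r) :=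
        lintegral_mono fun y => (setLIntegral_le_lintegral _ _).trans
          (lintegral_kernel_mul_min_le hα hr hs hrs hM (hφ0 y) y)
    _ = ENNReal.ofReal (2 * M ^ (s - 1) * (2 / α + 2 / (1 - 1 / r))) *
          ∫⁻ y in Icc (0 : ℝ) 1, ENNReal.ofReal (φ y ^ r) := by
        rw [← lintegral_const_mul _ (by fun_prop)]
        refine lintegral_congr fun y => ENNReal.ofReal_mul (by positivity)
    _ ≤ _ := mul_le_of_le_one_right' h1

/-- The Hardy–Littlewood–Sobolev inequality on `[0,1]`, with a constant that is uniform for `r` in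
`[r₀, p]`. -/
theorem exists_lintegral_rieszLIntegral_rpow_le {α r₀ p : ℝ} (hα : 0 < α) (hα1 : α < 1)
    (hr₀ : 1 < r₀) (hαp : α * p < 1) :
    ∃ D : ℝ, 1 ≤ D ∧ ∀ r s : ℝ, r₀ ≤ r → r ≤ p → α - 1 / r = -(1 / s) →
      ∀ φ : ℝ → ℝ, Measurable φ → (∀ y, 0 ≤ φ y) → ∀ A : ℝ, 0 < A →
      ∫⁻ y in Icc (0 : ℝ) 1, ENNReal.ofReal (φ y ^ r) ≤ ENNReal.ofReal (A ^ r) →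
      ∫⁻ x in Icc (0 : ℝ) 1, rieszLIntegral α φ x ^ s ≤ ENNReal.ofReal (D * A ^ s) := by
  have hd : 0 < 1 - α * p := by linarith
  have hr₀1 : 0 < 1 - 1 / r₀ := by rw [sub_pos, div_lt_one (by linarith)]; exact hr₀
  set q := p / (1 - α * p) with hq
  set c := max 1 (2 * (p - 1) / (1 - α * p)) with hc
  have hc1 : 1 ≤ c := le_max_left _ _
  set M := max (4 * c) (8 / α * (4 * c) ^ (α * q)) with hM
  have hM1 : 1 ≤ M := le_trans (by linarith) (le_max_left _ _)
  set D₀ := 2 * M ^ q * (2 / α + 2 / (1 - 1 / r₀)) with hD₀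
  refine ⟨max 1 D₀, le_max_left _ _, fun r s hr hrp hrs φ hφ hφ0 A hA hφA => ?_⟩
  have hr1 : 1 < r := by linarith
  have hr0 : 0 < r := by linarith
  have hαr : α * r < 1 := by nlinarith
  have hs : s = r / (1 - α * r) := by
    have h1 : s⁻¹ = (1 - α * r) / r := by
      rw [← one_div, ← neg_eq_iff_eq_neg.2 hrs]; field_simp; ring
    rw [← inv_inv s, h1, inv_div]
  have hs1 : 1 < s := by
    rw [hs, lt_div_iff₀ (by linarith)]; nlinarith
  have hsq : s ≤ q := by
    rw [hs, hq]; gcongr; linarith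
  have hA0 : A ≠ 0 := hA.ne'
  have key := lintegral_rieszLIntegral_rpow_le_of_le_one (φ := fun y => A⁻¹ * φ y) (c := c) (M := M)
    hα hα1 hr1 hαr hs1 hrs hc1 ?_ (le_max_left _ _) ?_ (by fun_prop)
    (fun y => by have := hφ0 y; positivity) ?_
  · have hscale : ∀ x, rieszLIntegral α φ x
        = ENNReal.ofReal A * rieszLIntegral α (fun y => A⁻¹ * φ y) x := by
      intro x
      unfold rieszLIntegral
      rw [← lintegral_const_mul _ (by fun_prop)]
      refine lintegral_congr fun y => ?_
      rw [← ENNReal.ofReal_mul hA.le]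
      congr 1; field_simp
    have hs0 : 0 ≤ s := by linarith
    simp only [hscale, ENNReal.mul_rpow_of_nonneg _ _ hs0]
    rw [lintegral_const_mul _ ((measurable_rieszLIntegral (by fun_prop)).pow_const s), mul_comm,
      ENNReal.ofReal_mul (by positivity), ENNReal.ofReal_rpow_of_pos hA]
    gcongr
    refine key.trans (ENNReal.ofReal_le_ofReal (le_trans ?_ (le_max_right _ _)))
    have h0 : 0 < 1 - 1 / r := by rw [sub_pos, div_lt_one hr0]; exact hr1
    have h1 : 0 ≤ 2 / α + 2 / (1 - 1 / r) := by positivity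
    rw [hD₀]
    gcongr
    linarith
  · refine le_trans ?_ (le_max_right _ _)
    gcongr
    linarith
  · refine le_trans ?_ (le_max_right _ _)
    gcongr
    linarith
  · have : ∀ y, ENNReal.ofReal ((A⁻¹ * φ y) ^ r)
        = ENNReal.ofReal ((A ^ r)⁻¹) * ENNReal.ofReal (φ y ^ r) := by
      intro y
      rw [Real.mul_rpow (by positivity) (hφ0 y), Real.inv_rpow hA.le,
        ENNReal.ofReal_mul (by positivity)]
    simp only [this]
    rw [lintegral_const_mul _ (by fun_prop)]
    calc _ ≤ ENNReal.ofReal ((A ^ r)⁻¹) * ENNReal.ofReal (A ^ r) := by gcongr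
      _ = 1 := by
        rw [← ENNReal.ofReal_mul (by positivity), inv_mul_cancel₀ (by positivity),
          ENNReal.ofReal_one]

/-! ### Norms on the unit interval -/

theorem lintegral_rpow_one_div_mono {μ : Measure ℝ} [IsProbabilityMeasure μ] {G : ℝ → ℝ≥0∞}
    (hG : Measurable G) {s t : ℝ} (hs : 0 < s) (hst : s ≤ t) :
    (∫⁻ x, G x ^ s ∂μ) ^ (1 / s) ≤ (∫⁻ x, G x ^ t ∂μ) ^ (1 / t) := by
  simpa [eLpNorm'] using eLpNorm'_le_eLpNorm'_of_exponent_le (μ := μ) hs hst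
    hG.aestronglyMeasurable

theorem grandNorm_Icc_le_iff {p θ : ℝ} {f : ℝ → ℝ} {a : ℝ≥0∞} :
    grandNorm (Icc 0 1) p θ f ≤ a ↔ ∀ ε ∈ Ioo (0 : ℝ) (p - 1),
      (ENNReal.ofReal (ε ^ θ) * ∫⁻ t in Icc (0 : ℝ) 1, ‖f t‖ₑ ^ (p - ε)) ^ (1 / (p - ε)) ≤ a := by
  simp [grandNorm, iSup_le_iff]

theorem grandNorm_congr_ae {Ω : Set ℝ} {p θ : ℝ} {f g : ℝ → ℝ}
    (h : f =ᵐ[volume.restrict Ω] g) : grandNorm Ω p θ f = grandNorm Ω p θ g := by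
  unfold grandNorm
  refine iSup_congr fun ε => iSup_congr fun _ => ?_
  have e : (fun t => ‖f t‖ₑ ^ (p - ε)) =ᵐ[volume.restrict Ω] fun t => ‖g t‖ₑ ^ (p - ε) :=
    h.mono fun t ht => by simp only [ht]
  rw [lintegral_congr_ae e]

/-! ### Estimate of the grand norm -/

/-- The exponents `s = q - η` and `r = p - ε` are related by `1 / s = 1 / r - α` when
`ε = η / ((1 + α q) (1 + α s))`. In particular `ε` and `η` are comparable. -/
theorem exists_exponent {p α q η : ℝ} (hp : 1 < p) (hα : 0 < α) (hαp : α * p < 1)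
    (hq : q = p / (1 - α * p)) (hη : 0 < η) (hηp : η ≤ (p - 1) / 2) :
    ∃ ε, 0 < ε ∧ ε ≤ (p - 1) / 2 ∧ η / (1 + α * q) ^ 2 ≤ ε ∧
      α - 1 / (p - ε) = -(1 / (q - η)) ∧ (q - η) / (p - ε) = 1 + α * (q - η) := by
  have hd : 0 < 1 - α * p := by linarith
  have hpq : p ≤ q := by
    rw [hq, le_div_iff₀ hd]; nlinarith [mul_pos hα (by linarith : 0 < p)]
  have hq0 : 0 < q := by linarith
  have hs0 : 0 < q - η := by linarith
  have h1 : 0 < 1 + α * q := by positivity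
  have h2 : 0 < 1 + α * (q - η) := by positivity
  have hpe : p = q / (1 + α * q) := by
    have := div_mul_cancel₀ p hd.ne'
    rw [← hq] at this
    rw [eq_div_iff h1.ne']; linear_combination -this
  have hr : p - η / ((1 + α * q) * (1 + α * (q - η))) = (q - η) / (1 + α * (q - η)) := by
    rw [hpe]
    field_simp
    ring
  refine ⟨η / ((1 + α * q) * (1 + α * (q - η))), by positivity, ?_, ?_, ?_, ?_⟩
  · refine (div_le_self hη.le ?_).trans hηp
    have : 0 < α * q := by positivity
    have : 0 < α * (q - η) := by positivity
    nlinarith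
  · rw [sq]
    gcongr
    linarith
  · rw [hr]; field_simp; ring
  · rw [hr]; field_simp

/-- The weight `η ^ θ₂` absorbs the loss `ε ^ (-θ₁ / r)` in the `L^r` norm, raised to the power `s`:
the total power of `η` is `θ₂ - θ₁ (1 + α s) ≥ 0`. -/
theorem weight_mul_rpow_le {α q η ε θ₁ θ₂ s : ℝ} (hα : 0 < α) (hs : 0 < s) (hsq : s ≤ q)
    (hη : 0 < η) (hη1 : η ≤ 1) (hε : η / (1 + α * q) ^ 2 ≤ ε) (hθ₁ : 0 < θ₁)
    (hθ : (1 + α * q) * θ₁ ≤ θ₂) :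
    η ^ θ₂ * ε ^ (-(θ₁ * (1 + α * s))) ≤ ((1 + α * q) ^ 2) ^ (θ₁ * (1 + α * q)) := by
  have hq : 0 < q := by linarith
  set κ := (1 + α * q) ^ 2 with hκ
  have hκ1 : 1 ≤ κ := one_le_pow₀ (by have : 0 < α * q := by positivity
                                      linarith)
  have hε0 : 0 < ε := lt_of_lt_of_le (by positivity) hε
  have hαs : α * s ≤ α * q := by gcongr
  have hb : 0 < θ₁ * (1 + α * s) := by positivity
  calc η ^ θ₂ * ε ^ (-(θ₁ * (1 + α * s)))
      ≤ η ^ θ₂ * (η / κ) ^ (-(θ₁ * (1 + α * s))) := by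
        gcongr ?_ * ?_
        exact Real.rpow_le_rpow_of_nonpos (by positivity) hε (by linarith)
    _ = η ^ (θ₂ - θ₁ * (1 + α * s)) * κ ^ (θ₁ * (1 + α * s)) := by
        rw [Real.div_rpow hη.le (by positivity), Real.rpow_sub hη, Real.rpow_neg hη.le,
          Real.rpow_neg (by positivity)]
        field_simp
    _ ≤ 1 * κ ^ (θ₁ * (1 + α * q)) := by
        gcongr
        exact Real.rpow_le_one hη.le hη1 (by nlinarith)
    _ = _ := one_mul _

/-- Exponents close to `q`: the Hardy–Littlewood–Sobolev inequality, together with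
`ε ≥ η / (1 + α q) ^ 2`. -/
theorem exists_grand_bound_near {p α θ₁ θ₂ q : ℝ} (hp : 1 < p) (hα : 0 < α) (hαp : α * p < 1)
    (hq : q = p / (1 - α * p)) (hθ₁ : 0 < θ₁) (hθ : (1 + α * q) * θ₁ ≤ θ₂) :
    ∃ E : ℝ, 1 ≤ E ∧ ∀ f : ℝ → ℝ, Measurable f → ∀ A : ℝ, 0 < A →
      grandNorm (Icc 0 1) p θ₁ f ≤ ENNReal.ofReal A →
      ∀ η, 0 < η → η ≤ 1 → η ≤ (p - 1) / 2 →
      ENNReal.ofReal (η ^ θ₂) * ∫⁻ x in Icc (0 : ℝ) 1, rieszLIntegral α (fun y => |f y|) x ^ (q - η)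
        ≤ ENNReal.ofReal ((E * A) ^ (q - η)) := by
  have hd : 0 < 1 - α * p := by linarith
  have hpq : p ≤ q := by
    rw [hq, le_div_iff₀ hd]; nlinarith [mul_pos hα (by linarith : 0 < p)]
  have hα1 : α < 1 := by nlinarith
  obtain ⟨D, hD1, hD⟩ := exists_lintegral_rieszLIntegral_rpow_le (r₀ := (1 + p) / 2) hα hα1
    (by linarith) hαp
  set κ := (1 + α * q) ^ 2 with hκ
  have hαq : 0 < α * q := mul_pos hα (by linarith)
  have hκ1 : 1 ≤ κ := one_le_pow₀ (by linarith)
  have hK1 : 1 ≤ κ ^ (θ₁ * (1 + α * q)) := Real.one_le_rpow hκ1 (by positivity)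
  refine ⟨D * κ ^ (θ₁ * (1 + α * q)), one_le_mul_of_one_le_of_one_le hD1 hK1,
    fun f hf A hA hfA η hη hη1 hηp => ?_⟩
  obtain ⟨ε, hε, hεp, hηε, hrs, hrs'⟩ := exists_exponent hp hα hαp hq hη hηp
  set r := p - ε with hr
  set s := q - η with hs
  have hr1 : 1 < r := by linarith
  have hr0 : 0 < r := by linarith
  have hs1 : 1 ≤ s := by linarith
  have h1 := grandNorm_Icc_le_iff.1 hfA ε ⟨hε, by linarith⟩
  rw [← hr, one_div, ENNReal.rpow_inv_le_iff hr0, ENNReal.ofReal_rpow_of_pos hA] at h1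
  have h2 : ∫⁻ y in Icc (0 : ℝ) 1, ENNReal.ofReal (|f y| ^ r)
      ≤ ENNReal.ofReal ((A * ε ^ (-(θ₁ / r))) ^ r) := by
    have e : ∀ y, ENNReal.ofReal (|f y| ^ r) = ‖f y‖ₑ ^ r := fun y => by
      rw [Real.enorm_eq_ofReal_abs, ENNReal.ofReal_rpow_of_nonneg (abs_nonneg _) hr0.le]
    simp only [e]
    have e2 : (A * ε ^ (-(θ₁ / r))) ^ r = (ε ^ θ₁)⁻¹ * A ^ r := by
      rw [Real.mul_rpow hA.le (by positivity), ← Real.rpow_mul hε.le, neg_mul,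
        div_mul_cancel₀ _ hr0.ne', Real.rpow_neg hε.le, mul_comm]
    rw [e2, ENNReal.ofReal_mul (by positivity), ENNReal.ofReal_inv_of_pos (by positivity)]
    rwa [mul_comm (_⁻¹), ← div_eq_mul_inv, ENNReal.le_div_iff_mul_le (by left; simp; positivity)
      (by left; simp), mul_comm]
  have h3 := hD r s (by linarith) (by linarith) hrs _ hf.abs (fun y => abs_nonneg _) _
    (by positivity) h2
  calc _ ≤ ENNReal.ofReal (η ^ θ₂) * ENNReal.ofReal (D * (A * ε ^ (-(θ₁ / r))) ^ s) := by gcongr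
    _ = ENNReal.ofReal (D * (η ^ θ₂ * ε ^ (-(θ₁ * (1 + α * s)))) * A ^ s) := by
        rw [← ENNReal.ofReal_mul (by positivity), Real.mul_rpow hA.le (by positivity),
          ← Real.rpow_mul hε.le, ← hrs']
        congr 1
        have : -(θ₁ / r) * s = -(θ₁ * (s / r)) := by ring
        rw [this]; ring
    _ ≤ ENNReal.ofReal ((D * κ ^ (θ₁ * (1 + α * q))) ^ s * A ^ s) := by
        refine ENNReal.ofReal_le_ofReal ?_
        gcongr
        calc _ ≤ D * κ ^ (θ₁ * (1 + α * q)) := by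
              gcongr
              exact weight_mul_rpow_le hα (by linarith) (by linarith) hη hη1 hηε hθ₁ hθ
          _ ≤ _ := Real.self_le_rpow_of_one_le (one_le_mul_of_one_le_of_one_le hD1 hK1) hs1
    _ = _ := by rw [Real.mul_rpow (by positivity) hA.le]

/-- All exponents `q - η`: those far from `q` are reduced to a single exponent `q - η₀` by the
monotonicity of `L^s` norms on a probability space. -/
theorem exists_grand_bound {p α θ₁ θ₂ q : ℝ} (hp : 1 < p) (hα : 0 < α) (hαp : α * p < 1)
    (hq : q = p / (1 - α * p)) (hθ₁ : 0 < θ₁) (hθ : (1 + α * q) * θ₁ ≤ θ₂) :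
    ∃ C : ℝ, 0 ≤ C ∧ ∀ f : ℝ → ℝ, Measurable f → ∀ A : ℝ, 0 < A →
      grandNorm (Icc 0 1) p θ₁ f ≤ ENNReal.ofReal A →
      ∀ η ∈ Ioo 0 (q - 1), (ENNReal.ofReal (η ^ θ₂) *
        ∫⁻ x in Icc (0 : ℝ) 1, rieszLIntegral α (fun y => |f y|) x ^ (q - η)) ^ (1 / (q - η))
        ≤ ENNReal.ofReal (C * A) := by
  have hd : 0 < 1 - α * p := by linarith
  have hpq : p ≤ q := by
    rw [hq, le_div_iff₀ hd]; nlinarith [mul_pos hα (by linarith : 0 < p)]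
  have hθ₂ : 0 < θ₂ := lt_of_lt_of_le (by have : 0 < α * q := mul_pos hα (by linarith)
                                          positivity) hθ
  obtain ⟨E, hE1, hE⟩ := exists_grand_bound_near hp hα hαp hq hθ₁ hθ
  set η₀ := min 1 ((p - 1) / 2) with hη₀
  have hη₀0 : 0 < η₀ := lt_min one_pos (by linarith)
  have hη₀1 : η₀ ≤ 1 := min_le_left _ _
  have hη₀p : η₀ ≤ (p - 1) / 2 := min_le_right _ _
  have hE0 : 0 < E := by linarith
  have hq1 : 1 ≤ q := by linarith
  have hqθ : 1 ≤ q ^ θ₂ := Real.one_le_rpow hq1 hθ₂.le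
  have hηθ : 1 ≤ η₀ ^ (-θ₂) := Real.one_le_rpow_of_pos_of_le_one_of_nonpos hη₀0 hη₀1 (by linarith)
  refine ⟨q ^ θ₂ * (η₀ ^ (-θ₂) * E), by positivity, fun f hf A hA hfA η hη => ?_⟩
  have hs : 1 < q - η := by linarith [hη.2]
  have hs0 : 0 < q - η := by linarith
  have near : ∀ η, 0 < η → η ≤ η₀ → (ENNReal.ofReal (η ^ θ₂) *
      ∫⁻ x in Icc (0 : ℝ) 1, rieszLIntegral α (fun y => |f y|) x ^ (q - η)) ^ (1 / (q - η))
        ≤ ENNReal.ofReal (E * A) := fun η h0 h => by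
    have : 0 < q - η := by linarith
    rw [one_div, ENNReal.rpow_inv_le_iff this, ENNReal.ofReal_rpow_of_pos (by positivity)]
    exact hE f hf A hA hfA η h0 (by linarith) (by linarith)
  rcases le_total η η₀ with h | h
  · refine (near η hη.1 h).trans (ENNReal.ofReal_le_ofReal ?_)
    gcongr
    have : 1 * (1 * E) ≤ q ^ θ₂ * (η₀ ^ (-θ₂) * E) := by gcongr
    linarith
  · have hG := measurable_rieszLIntegral (α := α) hf.abs
    have : IsProbabilityMeasure (volume.restrict (Icc (0 : ℝ) 1)) := ⟨by simp⟩
    have hs₀ : 1 < q - η₀ := by linarith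
    have hs₀0 : 0 < q - η₀ := by linarith
    have hmono := lintegral_rpow_one_div_mono (μ := volume.restrict (Icc (0 : ℝ) 1)) hG hs0
      (by linarith : q - η ≤ q - η₀)
    have h₀ := near η₀ hη₀0 le_rfl
    rw [ENNReal.mul_rpow_of_nonneg _ _ (by positivity),
      ENNReal.ofReal_rpow_of_pos (by positivity), ← Real.rpow_mul hη₀0.le] at h₀
    rw [ENNReal.mul_rpow_of_nonneg _ _ (by positivity),
      ENNReal.ofReal_rpow_of_pos (Real.rpow_pos_of_pos hη.1 _), ← Real.rpow_mul hη.1.le]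
    set N := (∫⁻ x in Icc (0 : ℝ) 1, rieszLIntegral α (fun y => |f y|) x ^ (q - η₀)) ^
      (1 / (q - η₀)) with hN
    have hdiv : ∀ u : ℝ, 1 < u → θ₂ * (1 / u) ≤ θ₂ := fun u hu => by
      rw [mul_one_div]; exact div_le_self hθ₂.le hu.le
    have hN' : N ≤ ENNReal.ofReal (η₀ ^ (-θ₂) * (E * A)) := by
      calc N = ENNReal.ofReal (η₀ ^ (-θ₂)) * (ENNReal.ofReal (η₀ ^ θ₂) * N) := by
            rw [← mul_assoc, ← ENNReal.ofReal_mul (by positivity), ← Real.rpow_add hη₀0]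
            simp
        _ ≤ ENNReal.ofReal (η₀ ^ (-θ₂)) *
              (ENNReal.ofReal (η₀ ^ (θ₂ * (1 / (q - η₀)))) * N) := by
            gcongr _ * (ENNReal.ofReal ?_ * _)
            exact Real.rpow_le_rpow_of_exponent_ge hη₀0 hη₀1 (hdiv _ hs₀)
        _ ≤ _ := by
            rw [ENNReal.ofReal_mul (by positivity)]
            gcongr
    calc _ ≤ ENNReal.ofReal (q ^ θ₂) * ENNReal.ofReal (η₀ ^ (-θ₂) * (E * A)) := by
          gcongr ?_ * ?_
          · refine ENNReal.ofReal_le_ofReal ?_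
            calc η ^ (θ₂ * (1 / (q - η))) ≤ q ^ (θ₂ * (1 / (q - η))) := by
                  gcongr
                  · exact hη.1.le
                  · linarith
              _ ≤ q ^ θ₂ := Real.rpow_le_rpow_of_exponent_le hq1 (hdiv _ hs)
          · exact hmono.trans hN'
      _ = _ := by
          rw [← ENNReal.ofReal_mul (by positivity)]
          congr 1; ring

/-! ### The real-valued potential -/

/-- This holds on the diagonal too, where both sides are `0` if `α ≠ 1` and `‖f y‖ₑ` if `α = 1`. -/
theorem enorm_rieszIntegrand (α : ℝ) (f : ℝ → ℝ) (x y : ℝ) :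
    ‖rieszIntegrand α f x y‖ₑ = ENNReal.ofReal (|f y| * |x - y| ^ (α - 1)) := by
  rw [rieszIntegrand, Real.enorm_eq_ofReal_abs, abs_div, abs_of_nonneg (by positivity :
    0 ≤ |x - y| ^ (1 - α)), div_eq_mul_inv, ← Real.rpow_neg (abs_nonneg _), neg_sub]

theorem enorm_rieszPotential_le (α : ℝ) (f : ℝ → ℝ) (x : ℝ) :
    ‖rieszPotential α f x‖ₑ ≤ rieszLIntegral α (fun y => |f y|) x := by
  unfold rieszPotential rieszLIntegral
  simp only [← enorm_rieszIntegrand]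
  exact enorm_integral_le_lintegral_enorm _

theorem measurable_rieszIntegrand {α : ℝ} {f : ℝ → ℝ} (hf : Measurable f) :
    Measurable fun z : ℝ × ℝ => rieszIntegrand α f z.1 z.2 := by
  unfold rieszIntegrand
  fun_prop

theorem measurable_rieszPotential {α : ℝ} {f : ℝ → ℝ} (hf : Measurable f) :
    Measurable (rieszPotential α f) := by
  have := (measurable_rieszIntegrand (α := α) hf).stronglyMeasurable.integral_prod_right'
    (ν := volume.restrict (Icc (0 : ℝ) 1))
  exact this.measurable

theorem rieszPotential_congr_ae {α : ℝ} {f g : ℝ → ℝ}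
    (h : f =ᵐ[volume.restrict (Icc (0 : ℝ) 1)] g) : rieszPotential α f = rieszPotential α g := by
  funext x
  exact integral_congr_ae (h.mono fun y hy => by simp only [rieszIntegrand, hy])

theorem ae_integrableOn_rieszIntegrand {p α θ : ℝ} (hp : 1 < p) (hα : 0 < α) {f : ℝ → ℝ}
    (hf : Measurable f) (hfp : grandNorm (Icc 0 1) p θ f < ∞) :
    ∀ᵐ x ∂(volume.restrict (Icc (0 : ℝ) 1)),
      IntegrableOn (rieszIntegrand α f x) (Icc 0 1) := by
  have hε : (p - 1) / 2 ∈ Ioo 0 (p - 1) := ⟨by linarith, by linarith⟩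
  have h1 := grandNorm_Icc_le_iff.1 (le_refl (grandNorm (Icc 0 1) p θ f)) ((p - 1) / 2) hε
  set r := p - (p - 1) / 2 with hr
  have hr0 : 1 < r := by rw [hr]; linarith
  have h2 : ∫⁻ y in Icc (0 : ℝ) 1, ENNReal.ofReal (|f y| ^ r) ≠ ∞ := by
    have e : ∀ y, ENNReal.ofReal (|f y| ^ r) = ‖f y‖ₑ ^ r := fun y => by
      rw [Real.enorm_eq_ofReal_abs, ENNReal.ofReal_rpow_of_nonneg (abs_nonneg _) (by linarith)]
    simp only [e]
    intro h
    rw [h, ENNReal.mul_top (by simpa using Real.rpow_pos_of_pos hε.1 θ),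
      ENNReal.top_rpow_of_pos (by positivity)] at h1
    exact (h1.trans_lt hfp).ne rfl
  refine (ae_rieszLIntegral_ne_top hα hr0.le hf.abs (fun y => abs_nonneg _) h2).mono fun x hx => ?_
  refine ⟨((measurable_rieszIntegrand hf).comp measurable_prodMk_left).aestronglyMeasurable, ?_⟩
  rw [hasFiniteIntegral_iff_enorm]
  simp only [enorm_rieszIntegrand]
  exact hx.lt_top

theorem exists_grandNorm_rieszPotential_le {p α θ₁ θ₂ q : ℝ} (hp : 1 < p) (hα : 0 < α)
    (hαp : α * p < 1) (hq : q = p / (1 - α * p)) (hθ₁ : 0 < θ₁) (hθ : (1 + α * q) * θ₁ ≤ θ₂) :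
    ∃ C : ℝ≥0, ∀ f : ℝ → ℝ, Measurable f → grandNorm (Icc 0 1) p θ₁ f < ∞ →
      grandNorm (Icc 0 1) q θ₂ (rieszPotential α f) ≤ C * grandNorm (Icc 0 1) p θ₁ f := by
  obtain ⟨C, hC0, hC⟩ := exists_grand_bound hp hα hαp hq hθ₁ hθ
  refine ⟨C.toNNReal, fun f hf hfp => ?_⟩
  -- It suffices to bound by `C * A` for every real `A` above the norm of `f`.
  have hA : ∀ b > grandNorm (Icc 0 1) p θ₁ f, b ≠ ∞ →
      grandNorm (Icc 0 1) q θ₂ (rieszPotential α f) ≤ C.toNNReal * b := by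
    intro b hb hbt
    have hb0 : 0 < b.toReal := ENNReal.toReal_pos (pos_of_gt hb).ne' hbt
    have hfA : grandNorm (Icc 0 1) p θ₁ f ≤ ENNReal.ofReal b.toReal := by
      rw [ENNReal.ofReal_toReal hbt]; exact hb.le
    refine grandNorm_Icc_le_iff.2 fun η hη => ?_
    have hs : 0 < q - η := by linarith [hη.2]
    calc _ ≤ (ENNReal.ofReal (η ^ θ₂) * ∫⁻ x in Icc (0 : ℝ) 1,
            rieszLIntegral α (fun y => |f y|) x ^ (q - η)) ^ (1 / (q - η)) := by
          gcongr
          exact enorm_rieszPotential_le α f _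
      _ ≤ _ := hC f hf _ hb0 hfA η hη
      _ = _ := by rw [ENNReal.ofReal_mul hC0, ENNReal.ofReal_toReal hbt, ENNReal.ofReal]
  refine ENNReal.le_mul_of_forall_lt (Or.inr hfp.ne) (Or.inl ENNReal.coe_ne_top)
    fun c hc b hb => ?_
  rcases eq_or_ne b ∞ with rfl | hbt
  · rw [ENNReal.mul_top (pos_of_gt hc).ne']; exact le_top
  · exact (hA b hb hbt).trans (by gcongr)

/-- Boundedness of `I_α` from `L^{p),θ₁}([0,1])` to `L^{q),θ₂}([0,1])`: with a constant that does
not depend on `f`, for every `f` in the first space the integral defining `I_α f` converges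
absolutely at almost every point of `[0,1]`, `I_α f` lies in the second space, and the norm
inequality holds. -/
theorem corollary3p1 (p α θ₁ θ₂ q : ℝ) (hp : 1 < p) (hα : 0 < α) (hαp : α < 1 / p)
    (hq : q = p / (1 - α * p)) (hθ₁ : 0 < θ₁) (hθ : (1 + α * q) * θ₁ < θ₂) :
    ∃ C : ℝ≥0, ∀ f : ℝ → ℝ, MemGrandLebesgue (Icc 0 1) p θ₁ f →
      (∀ᵐ x ∂(volume.restrict (Icc (0 : ℝ) 1)),
        IntegrableOn (rieszIntegrand α f x) (Icc 0 1)) ∧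
      MemGrandLebesgue (Icc 0 1) q θ₂ (rieszPotential α f) ∧
      grandNorm (Icc 0 1) q θ₂ (rieszPotential α f) ≤ C * grandNorm (Icc 0 1) p θ₁ f := by
  have hαp' : α * p < 1 := by rwa [lt_div_iff₀ (by linarith)] at hαp
  obtain ⟨C, hC⟩ := exists_grandNorm_rieszPotential_le hp hα hαp' hq hθ₁ hθ.le
  refine ⟨C, fun f ⟨hf, hfp⟩ => ?_⟩
  obtain ⟨g, hg, hfg⟩ := hf.aemeasurable
  rw [grandNorm_congr_ae hfg] at hfp ⊢
  rw [rieszPotential_congr_ae hfg]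
  have hle := hC g hg hfp
  refine ⟨(ae_integrableOn_rieszIntegrand hp hα hg hfp).mono fun x hx => ?_,
    ⟨(measurable_rieszPotential hg).aestronglyMeasurable, ?_⟩, hle⟩
  · exact hx.congr (hfg.mono fun y hy => by simp only [rieszIntegrand, hy])
  · exact hle.trans_lt (ENNReal.mul_lt_top ENNReal.coe_lt_top hfp)
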